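/- Let $(X,\mathcal B_X,\mu)$ be a probability space and let $(T^{(m,n)})_{(m,n)\in\mathbb Z^2}$ be a measure preserving action of $\mathbb Z^2$ on it: each $T^{(m,n)}:X\to X$ is measurable and preserves $\mu$, $T^{(0,0)}=\mathrm{id}_X$, and $T^{(m,n)}\circ T^{(m',n')}=T^{(m+m',n+n')}$. Write $T^{-(m,n)}B=\{x: T^{(m,n)}x\in B\}$. Let $\beta\in\mathbb R$ and $\vec v=(1,\beta)$. For $b>0$ and $k\in\mathbb N$ put $$\Lambda^{\vec v}(b)=\{(m,n)\in\mathbb Z^2:\ \beta m-b/2\le n\le \beta m+b/2\},\qquad \Lambda^{\vec v}_k(b)=\Lambda^{\vec v}(b)\cap([0,k-1]\times\mathbb Z).$$ Let $U_T^{(m,n)}f=f\circ T^{(m,n)}$ on the complex Hilbert space $L^2(X,\mathcal B_X,\mu)$. Fix any $b_0>0$ and let the $\vec v$-directional Kronecker algebra be $$\mathcal K_\mu^{\vec v}=\left\{B\in\mathcal B_X:\ \overline{\{U_T^{(m,n)}1_B:(m,n)\in\Lambda^{\vec v}(b_0)\}}\ \text{is compact in } L^2(X,\mathcal B_X,\mu)\right\}.$$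 The system is called $\vec v$-weakly mixing if $\mathcal K_\mu^{\vec v}$ is trivial, that is, equal to $\{\emptyset,X\}$ up to $\mu$-null sets: $\mu(B)\in\{0,1\}$ for every $B\in\mathcal K_\mu^{\vec v}$. Then, for every choice of $b_0>0$, the following are equivalent: (a) the system is $\vec v$-weakly mixing; (b) there exists $b>0$ such that for all $B,C\in\mathcal B_X$ $$\lim_{k\to\infty}\frac1{\#\Lambda_k^{\vec v}(b)}\sum_{(m,n)\in\Lambda_k^{\vec v}(b)}\left|\mu(T^{-(m,n)}B\cap C)-\mu(B)\mu(C)\right|=0;$$ (c) for every $b>0$ and all $B,C\in\mathcal B_X$ $$\lim_{k\to\infty}\frac1{\#\Lambda_k^{\vec v}(b)}\sum_{(m,n)\in\Lambda_k^{\vec v}(b)}\left|\mu(T^{-(m,n)}B\cap C)-\mu(B)\mu(C)\right|=0.$$ -/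

import Mathlib

open MeasureTheory Filter Topology

noncomputable section

namespace DirWM

/-- The strip `Λ^v(b)` of width `b > 0` around the line through the origin in the direction
`v = (1, β)`: all `(m, n) ∈ ℤ²` with `β m - b / 2 ≤ n ≤ β m + b / 2`. -/
def strip (β b : ℝ) : Set (ℤ × ℤ) :=
  {p | β * (p.1 : ℝ) - b / 2 ≤ (p.2 : ℝ) ∧ (p.2 : ℝ) ≤ β * (p.1 : ℝ) + b / 2}

/-- `Λ_k^v(b) = Λ^v(b) ∩ ([0, k - 1] × ℤ)`. -/
def stripSection (β b : ℝ) (k : ℕ) : Set (ℤ × ℤ) :=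
  strip β b ∩ {p | 0 ≤ p.1 ∧ p.1 ≤ (k : ℤ) - 1}

theorem stripSection_finite (β b : ℝ) (k : ℕ) : (stripSection β b k).Finite := by
  refine Set.Finite.subset
    (((Set.finite_Icc (0 : ℤ) ((k : ℤ) - 1)).biUnion (t := fun m : ℤ =>
      ({m} : Set ℤ) ×ˢ Set.Icc ⌈β * (m : ℝ) - b / 2⌉ ⌊β * (m : ℝ) + b / 2⌋)
      fun m _ => (Set.finite_singleton m).prod (Set.finite_Icc _ _))) ?_
  rintro ⟨m, n⟩ ⟨⟨h1, h2⟩, h3, h4⟩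
  refine Set.mem_biUnion (x := m) ⟨h3, h4⟩ ⟨rfl, ?_, ?_⟩
  · exact Int.ceil_le.2 h1
  · exact Int.le_floor.2 h2

/-- `Λ_k^v(b)` as a finite set, over which one can sum. -/
def stripFinset (β b : ℝ) (k : ℕ) : Finset (ℤ × ℤ) :=
  (stripSection_finite β b k).toFinset

variable {X : Type*} [MeasurableSpace X] [AddAction (ℤ × ℤ) X]
  [MeasurableConstVAdd (ℤ × ℤ) X]

/-- The Koopman operator `U_T^p f = f ∘ T^p` on the complex Hilbert space `L²(X, μ)`, where
`T^p x = p +ᵥ x` is the measure preserving action of `p ∈ ℤ²`. -/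
def koopman (μ : Measure X) [VAddInvariantMeasure (ℤ × ℤ) X μ] (p : ℤ × ℤ) :
    Lp ℂ 2 μ →ₗᵢ[ℂ] Lp ℂ 2 μ :=
  Lp.compMeasurePreservingₗᵢ ℂ (fun x : X => p +ᵥ x) (measurePreserving_vadd p μ)

/-- The directional Kronecker algebra in the direction `(1, β)`, computed with the strip of
width `b`: the measurable sets `B` such that the closure of
`{U_T^p 1_B : p ∈ Λ^v(b)}` is compact in `L²(X, μ)`. -/
def kroneckerAlgebra (μ : Measure X) [IsProbabilityMeasure μ]
    [VAddInvariantMeasure (ℤ × ℤ) X μ] (β b : ℝ) : Set (Set X) :=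
  {B | ∃ hB : MeasurableSet B, IsCompact (closure
    ((fun p : ℤ × ℤ => koopman μ p (indicatorConstLp 2 hB (measure_ne_top μ B) (1 : ℂ))) ''
      strip β b))}

/-- Directional weak mixing: the directional Kronecker algebra is trivial, that is, equal to
`{∅, X}` up to sets of measure zero. -/
def IsWeakMixing (μ : Measure X) [IsProbabilityMeasure μ]
    [VAddInvariantMeasure (ℤ × ℤ) X μ] (β b : ℝ) : Prop :=
  ∀ B ∈ kroneckerAlgebra μ β b, μ B = 0 ∨ μ B = 1

/-- The average of `|μ(T^{-p} B ∩ C) - μ(B) μ(C)|` over `p ∈ Λ_k^v(b)`. -/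
def correlationAverage (μ : Measure X) (β b : ℝ) (B C : Set X) (k : ℕ) : ℝ :=
  (1 / ((stripFinset β b k).card : ℝ)) * ∑ p ∈ stripFinset β b k,
    |μ.real ((fun x : X => p +ᵥ x) ⁻¹' B ∩ C) - μ.real B * μ.real C|

/-- For all measurable `B`, `C`, the averages over `Λ_k^v(b)` tend to `0` as `k → ∞`. -/
def AveragesVanish (μ : Measure X) (β b : ℝ) : Prop :=
  ∀ B C : Set X, MeasurableSet B → MeasurableSet C →
    Tendsto (fun k : ℕ => correlationAverage μ β b B C k) atTop (𝓝 0)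

end DirWM

end

namespace DirWM

/-! (b) ⇒ (a), `AveragesVanish.isWeakMixing`: if `B` is in the Kronecker algebra, finitely many
translates of `B` approximate its whole orbit along the strip, so every `T^{-p} B` correlates with
one of them; for `0 < μ(B) < 1` the averages cannot all vanish.

(a) ⇒ (c), `IsWeakMixing.averagesVanish`: if the averages for `B, C` do not vanish, take limits
along an ultrafilter of bad times `k`. With `g, f` the centered indicators of `B, C`, let `w` be the
weak mean of `⟨f, V^p g⟩ V^p g` over the strip. Then `⟨w, f⟩` is the mean of `⟨f, V^p g⟩²`, which is
positive. The quadratic form `z ↦` mean of `⟨V^p g, z⟩²` has finite trace by Bessel, so it is small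
off a finite-dimensional space; it controls `⟨V^q w, z⟩` uniformly for `q` in a strip, so the orbit
of `w` is totally bounded (`exists_totallyBounded_orbit`). As `w` is nonzero of mean zero, `{w > 0}`
has measure strictly between 0 and 1, and it lies in the Kronecker algebra
(`setOf_pos_mem_kroneckerAlgebra`).

Strips are not invariant under their own translations; this costs only a wider strip, and any strip
is covered by finitely many translates of any other. -/

/-! ### Strips: coverings and point counts. -/

theorem mem_strip {β b : ℝ} {p : ℤ × ℤ} : p ∈ strip β b ↔ |(p.2 : ℝ) - β * p.1| ≤ b / 2 := by
  rw [abs_le]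
  constructor
  · rintro ⟨h1, h2⟩
    constructor <;> linarith
  · rintro ⟨h1, h2⟩
    constructor <;> linarith

theorem add_mem_strip {β b b' : ℝ} {p q : ℤ × ℤ} (hp : p ∈ strip β b) (hq : q ∈ strip β b') :
    p + q ∈ strip β (b + b') := by
  rw [mem_strip] at *
  rw [abs_le] at *
  simp only [Prod.fst_add, Prod.snd_add]
  push_cast
  constructor <;> nlinarith

theorem mem_stripFinset {β b : ℝ} {k : ℕ} {p : ℤ × ℤ} :
    p ∈ stripFinset β b k ↔ p ∈ strip β b ∧ 0 ≤ p.1 ∧ p.1 < k := by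
  simp [stripFinset, stripSection]

/-- A totally bounded family has finite nets consisting of members of the family. -/
theorem exists_finset_net {ι α : Type*} [PseudoMetricSpace α] {t : ι → α} {S : Set ι}
    (h : TotallyBounded (t '' S)) {ε : ℝ} (hε : 0 < ε) :
    ∃ F : Finset ι, ↑F ⊆ S ∧ ∀ p ∈ S, ∃ f ∈ F, dist (t p) (t f) < ε := by
  obtain ⟨s, hs, hfin, hcov⟩ := Metric.finite_approx_of_totallyBounded h ε hε
  obtain ⟨F, hFS, rfl⟩ := Set.subset_image_iff.1 hs
  -- The finite net consists of values of `t`; one index is kept for each value.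
  obtain ⟨G, hG, hGs⟩ := Set.exists_subset_bijOn F t
  have hGfin : G.Finite := Set.Finite.of_finite_image (hGs.image_eq ▸ hfin) hGs.injOn
  refine ⟨hGfin.toFinset, by simpa using hG.trans hFS, fun p hp => ?_⟩
  have h1 := hcov ⟨p, hp, rfl⟩
  simp only [Set.mem_iUnion, Metric.mem_ball, exists_prop] at h1
  obtain ⟨y, hy, hyd⟩ := h1
  rw [← hGs.image_eq] at hy
  obtain ⟨f, hf, rfl⟩ := hy
  exact ⟨f, by simpa using hf, hyd⟩

/-- A strip is covered by finitely many translates of any other strip. -/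
theorem exists_finset_cover_strip (β : ℝ) {b : ℝ} (hb : 0 < b) (b' : ℝ) :
    ∃ F : Finset (ℤ × ℤ), ∀ p ∈ strip β b', ∃ f ∈ F, p - f ∈ strip β b := by
  -- The strip is the preimage of a bounded interval under the additive map `t`, so a `b / 2`-net of
  -- its image gives the translates.
  let t : ℤ × ℤ → ℝ := fun p => (p.2 : ℝ) - β * p.1
  have htb : TotallyBounded (t '' strip β b') := by
    refine (isCompact_Icc (a := -(b' / 2)) (b := b' / 2)).totallyBounded.subset ?_
    rintro _ ⟨p, hp, rfl⟩
    exact abs_le.1 (mem_strip.1 hp)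
  obtain ⟨F, -, hF⟩ := exists_finset_net htb (half_pos hb)
  refine ⟨F, fun p hp => ?_⟩
  obtain ⟨f, hf, hd⟩ := hF p hp
  refine ⟨f, hf, mem_strip.2 ?_⟩
  rw [Real.dist_eq] at hd
  refine le_trans (le_of_eq ?_) hd.le
  simp only [t, Prod.fst_sub, Prod.snd_sub]
  push_cast
  congr 1
  ring

theorem round_mem_strip (β : ℝ) (m : ℤ) : (m, round (β * m)) ∈ strip β 1 := by
  rw [mem_strip, abs_sub_comm]
  exact abs_sub_round _

theorem zero_mem_strip (β : ℝ) {b : ℝ} (hb : 0 < b) : (0 : ℤ × ℤ) ∈ strip β b := by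
  rw [mem_strip]
  simpa using by positivity

/-- The number of points of `Λ_k(b)` grows at least linearly in `k`. -/
theorem exists_le_mul_card_stripFinset (β : ℝ) {b : ℝ} (hb : 0 < b) :
    ∃ L : ℝ, 0 < L ∧ ∀ᶠ k : ℕ in atTop, (k : ℝ) ≤ L * (stripFinset β b k).card := by
  classical
  obtain ⟨F, hF⟩ := exists_finset_cover_strip β hb 1
  obtain ⟨J, hJ⟩ : ∃ J : ℕ, ∀ f ∈ F, |f.1| ≤ J := by
    refine ⟨F.sup fun f => f.1.natAbs, fun f hf => ?_⟩
    have := Finset.le_sup (f := fun f : ℤ × ℤ => f.1.natAbs) hf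
    exact (Int.natCast_natAbs f.1).symm.trans_le (by exact_mod_cast this)
  -- Each `m` in `[J, k - J)` is a first coordinate from `F` plus one from `Λ_k`, so `k - 2J ≤ #F ·
  -- #Λ_k`; and `k ≥ 4J` gives `k ≤ 2(k - 2J)`.
  refine ⟨2 * (F.card + 1), by positivity, ?_⟩
  filter_upwards [eventually_ge_atTop (4 * J)] with k hk
  have hsub : Finset.Ico (J : ℤ) (k - J) ⊆
      (F ×ˢ stripFinset β b k).image fun x => x.1.1 + x.2.1 := by
    intro m hm
    rw [Finset.mem_Ico] at hm
    obtain ⟨f, hf, hfs⟩ := hF _ (round_mem_strip β m)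
    have := abs_le.1 (hJ f hf)
    rw [Finset.mem_image]
    refine ⟨(f, (m, round (β * m)) - f), ?_, by simp⟩
    rw [Finset.mem_product, mem_stripFinset]
    refine ⟨hf, hfs, ?_, ?_⟩ <;> simp only [Prod.fst_sub] <;> omega
  have hcard := (Finset.card_le_card hsub).trans Finset.card_image_le
  rw [Finset.card_product, Int.card_Ico] at hcard
  have h2 : (k : ℤ) - J - J ≤ (F.card * (stripFinset β b k).card : ℕ) := by omega
  have h3 : (k : ℝ) - J - J ≤ F.card * (stripFinset β b k).card := by exact_mod_cast h2
  have h4 : (4 : ℝ) * J ≤ k := by exact_mod_cast hk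
  have h5 : (0 : ℝ) ≤ (stripFinset β b k).card := by positivity
  nlinarith

/-- The points of the strip over `m`. -/
noncomputable def stripFiber (β b : ℝ) (m : ℤ) : Finset ℤ :=
  Finset.Icc ⌈β * (m : ℝ) - b / 2⌉ ⌊β * (m : ℝ) + b / 2⌋

theorem mem_stripFiber {β b : ℝ} {m n : ℤ} : n ∈ stripFiber β b m ↔ (m, n) ∈ strip β b := by
  rw [stripFiber, Finset.mem_Icc, Int.ceil_le, Int.le_floor]
  rfl

theorem card_stripFiber_le (β : ℝ) {b : ℝ} (hb : 0 < b) (m : ℤ) :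
    ((stripFiber β b m).card : ℝ) ≤ b + 1 := by
  rw [stripFiber, Int.card_Icc]
  have h1 := Int.floor_le (β * (m : ℝ) + b / 2)
  have h2 := Int.le_ceil (β * (m : ℝ) - b / 2)
  rcases le_total 0 (⌊β * (m : ℝ) + b / 2⌋ + 1 - ⌈β * (m : ℝ) - b / 2⌉) with h | h
  · have : (((⌊β * (m : ℝ) + b / 2⌋ + 1 - ⌈β * (m : ℝ) - b / 2⌉).toNat : ℤ) : ℝ)
        = ((⌊β * (m : ℝ) + b / 2⌋ + 1 - ⌈β * (m : ℝ) - b / 2⌉ : ℤ) : ℝ) := by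
      rw [Int.toNat_of_nonneg h]
    rw [Int.cast_natCast] at this
    rw [this]
    push_cast
    linarith
  · rw [Int.toNat_of_nonpos h]
    simp only [Nat.cast_zero]
    linarith

theorem sum_stripFinset (β b : ℝ) (k : ℕ) (c : ℤ × ℤ → ℝ) :
    ∑ p ∈ stripFinset β b k, c p =
      ∑ m ∈ Finset.range k, ∑ n ∈ stripFiber β b (m : ℤ), c ((m : ℤ), n) := by
  rw [Finset.sum_finset_product (stripFinset β b k)
    ((Finset.range k).map Nat.castEmbedding) (stripFiber β b), Finset.sum_map]
  · rfl
  · rintro ⟨m, n⟩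
    rw [mem_stripFinset, mem_stripFiber, Finset.mem_map]
    constructor
    · rintro ⟨h1, h2, h3⟩
      refine ⟨⟨m.toNat, ?_, ?_⟩, h1⟩
      · rw [Finset.mem_range]
        dsimp only at h2 h3
        omega
      · exact Int.toNat_of_nonneg h2
    · rintro ⟨⟨j, hj, rfl⟩, h⟩
      rw [Finset.mem_range] at hj
      exact ⟨h, by simp, by simpa using hj⟩

/-! ### Averages along a strip and their ultrafilter limits. -/

/-- The sum of `c` over `Λ_k(b)`, normalised by `k`. -/
noncomputable def stripAvg (β b : ℝ) (c : ℤ × ℤ → ℝ) (k : ℕ) : ℝ :=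
  (1 / (k : ℝ)) * ∑ p ∈ stripFinset β b k, c p

theorem stripAvg_mono {β b : ℝ} {c d : ℤ × ℤ → ℝ} (h : ∀ p, c p ≤ d p) (k : ℕ) :
    stripAvg β b c k ≤ stripAvg β b d k :=
  mul_le_mul_of_nonneg_left (Finset.sum_le_sum fun p _ => h p) (by positivity)

theorem stripAvg_const_le (β : ℝ) {b : ℝ} (hb : 0 < b) {C : ℝ} (hC : 0 ≤ C) (k : ℕ) :
    stripAvg β b (fun _ => C) k ≤ C * (b + 1) := by
  rw [stripAvg, sum_stripFinset]
  have h : ∑ m ∈ Finset.range k, ∑ n ∈ stripFiber β b (m : ℤ), C ≤ k * (C * (b + 1)) := by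
    refine (Finset.sum_le_card_nsmul _ _ (C * (b + 1)) fun m _ => ?_).trans (by simp)
    rw [Finset.sum_const, nsmul_eq_mul, mul_comm]
    exact mul_le_mul_of_nonneg_left (card_stripFiber_le β hb _) hC
  rcases Nat.eq_zero_or_pos k with rfl | hk
  · simp
    positivity
  · have hk' : (0 : ℝ) < k := by exact_mod_cast hk
    rw [one_div, inv_mul_le_iff₀ hk']
    exact h

theorem abs_stripAvg_le (β : ℝ) {b : ℝ} (hb : 0 < b) {C : ℝ} {c : ℤ × ℤ → ℝ}
    (hc : ∀ p, |c p| ≤ C) (k : ℕ) : |stripAvg β b c k| ≤ C * (b + 1) := by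
  have hC : 0 ≤ C := (abs_nonneg _).trans (hc 0)
  refine le_trans ?_ (stripAvg_const_le β hb hC k)
  rw [stripAvg, stripAvg, abs_mul, abs_of_nonneg (by positivity : (0 : ℝ) ≤ 1 / k)]
  exact mul_le_mul_of_nonneg_left
    ((Finset.abs_sum_le_sum_abs _ _).trans (Finset.sum_le_sum fun p _ => hc p)) (by positivity)

/-- The limit of the averages of `c` over the strip along an ultrafilter. -/
noncomputable def stripMean (U : Ultrafilter ℕ) (β b : ℝ) (c : ℤ × ℤ → ℝ) : ℝ :=
  limUnder (U : Filter ℕ) (stripAvg β b c)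

/-- For bounded `c` the averages stay in a compact interval, where every ultrafilter converges; so
`limUnder` is a genuine limit here and not a default value. -/
theorem tendsto_stripMean (U : Ultrafilter ℕ) (β : ℝ) {b : ℝ} (hb : 0 < b) {C : ℝ}
    {c : ℤ × ℤ → ℝ} (hc : ∀ p, |c p| ≤ C) :
    Tendsto (stripAvg β b c) U (𝓝 (stripMean U β b c)) := by
  obtain ⟨x, -, hx⟩ := (isCompact_Icc (a := -(C * (b + 1))) (b := C * (b + 1))).ultrafilter_le_nhds
    (U.map (stripAvg β b c)) (by
      rw [le_principal_iff, Ultrafilter.coe_map]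
      exact Filter.mem_map.2 (Filter.univ_mem' fun k => abs_le.1 (abs_stripAvg_le β hb hc k)))
  exact tendsto_nhds_limUnder ⟨x, hx⟩

/-- Averages over an interval of integers are asymptotically translation invariant. -/
theorem tendsto_avg_translate {a : ℤ → ℝ} {C : ℝ} (ha : ∀ m, |a m| ≤ C) (j : ℤ) :
    Tendsto (fun k : ℕ => (1 / (k : ℝ)) * ∑ m ∈ Finset.range k, a (m + j) -
      (1 / (k : ℝ)) * ∑ m ∈ Finset.range k, a m) atTop (𝓝 0) := by
  -- A shift by one telescopes to two boundary terms, which is `O(1/k)`; induction on `j` does the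
  -- rest.
  have step : ∀ i : ℤ, Tendsto (fun k : ℕ => (1 / (k : ℝ)) * ∑ m ∈ Finset.range k, a (m + (i + 1)) -
      (1 / (k : ℝ)) * ∑ m ∈ Finset.range k, a (m + i)) atTop (𝓝 0) := by
    intro i
    have h : ∀ k : ℕ, (1 / (k : ℝ)) * ∑ m ∈ Finset.range k, a (m + (i + 1)) -
        (1 / (k : ℝ)) * ∑ m ∈ Finset.range k, a (m + i) =
        (1 / (k : ℝ)) * (a (k + i) - a i) := by
      intro k
      rw [← mul_sub, ← Finset.sum_sub_distrib]
      have := Finset.sum_range_sub (fun m : ℕ => a (m + i)) k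
      simp only [Nat.cast_zero, zero_add] at this
      rw [← this]
      congr 1
      refine Finset.sum_congr rfl fun m _ => ?_
      push_cast
      rw [add_right_comm, add_assoc (m : ℤ) i 1]
    simp_rw [h]
    refine squeeze_zero_norm (a := fun k : ℕ => (1 / (k : ℝ)) * (2 * C)) (fun k => ?_) ?_
    · rw [Real.norm_eq_abs, abs_mul, abs_of_nonneg (by positivity : (0 : ℝ) ≤ 1 / k)]
      refine mul_le_mul_of_nonneg_left ?_ (by positivity)
      have := abs_sub (a (k + i)) (a i)
      linarith [ha (k + i), ha i]
    · simpa using tendsto_one_div_atTop_nhds_zero_nat.mul_const (2 * C)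
  induction j using Int.induction_on with
  | zero => simp
  | succ i ih =>
    have := (step i).add ih
    simpa using this
  | pred i ih =>
    have := ih.sub (step (-i - 1))
    simpa using this

variable {U : Ultrafilter ℕ} {β b : ℝ} {c d : ℤ × ℤ → ℝ} {C D : ℝ}

theorem stripMean_mono (hb : 0 < b) (hc : ∀ p, |c p| ≤ C) (hd : ∀ p, |d p| ≤ D)
    (h : ∀ p, c p ≤ d p) : stripMean U β b c ≤ stripMean U β b d :=
  le_of_tendsto_of_tendsto' (tendsto_stripMean U β hb hc) (tendsto_stripMean U β hb hd)
    (stripAvg_mono h)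

theorem abs_stripMean_le (hb : 0 < b) (hc : ∀ p, |c p| ≤ C) :
    |stripMean U β b c| ≤ C * (b + 1) := by
  have h := tendsto_stripMean U β hb hc
  exact le_of_tendsto' h.abs (abs_stripAvg_le β hb hc)

theorem stripMean_add (hb : 0 < b) (hc : ∀ p, |c p| ≤ C) (hd : ∀ p, |d p| ≤ D) :
    stripMean U β b (fun p => c p + d p) = stripMean U β b c + stripMean U β b d := by
  refine Tendsto.limUnder_eq (((tendsto_stripMean U β hb hc).add
    (tendsto_stripMean U β hb hd)).congr fun k => ?_)
  rw [stripAvg, stripAvg, stripAvg, Finset.sum_add_distrib, mul_add]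

theorem stripMean_const_mul (hb : 0 < b) (hc : ∀ p, |c p| ≤ C) (r : ℝ) :
    stripMean U β b (fun p => r * c p) = r * stripMean U β b c := by
  refine Tendsto.limUnder_eq (((tendsto_stripMean U β hb hc).const_mul r).congr fun k => ?_)
  rw [stripAvg, stripAvg, ← Finset.mul_sum, mul_left_comm]

theorem stripMean_sum {ι : Type*} (s : Finset ι) (hb : 0 < b) {e : ι → ℤ × ℤ → ℝ}
    (he : ∀ i p, |e i p| ≤ C) :
    stripMean U β b (fun p => ∑ i ∈ s, e i p) = ∑ i ∈ s, stripMean U β b (e i) := by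
  refine Tendsto.limUnder_eq ((tendsto_finsetSum s fun i _ =>
    tendsto_stripMean U β hb (he i)).congr fun k => ?_)
  simp_rw [stripAvg]
  rw [← Finset.mul_sum, Finset.sum_comm]

/-- Translating by a point of a strip is dominated by enlarging the strip. -/
theorem stripMean_translate_le (hU : (U : Filter ℕ) ≤ atTop) (hb : 0 < b) {b' : ℝ} (hb' : 0 < b')
    (hc : ∀ p, |c p| ≤ C) (h0 : ∀ p, 0 ≤ c p) {q : ℤ × ℤ} (hq : q ∈ strip β b') :
    stripMean U β b (fun p => c (p + q)) ≤ stripMean U β (b + b') c := by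
  have hC : 0 ≤ C := (abs_nonneg _).trans (hc 0)
  -- Column sums over the wide strip. Translation by `q` sends the narrow column over `m` into the
  -- wide column over `m + q.1`; since `c ≥ 0` the surplus points may be added, and only a
  -- horizontal shift remains.
  let a : ℤ → ℝ := fun m => ∑ n ∈ stripFiber β (b + b') m, c (m, n)
  have ha : ∀ m, |a m| ≤ (b + b' + 1) * C := fun m => by
    refine (Finset.abs_sum_le_sum_abs _ _).trans ?_
    refine (Finset.sum_le_card_nsmul _ _ C fun n _ => hc _).trans ?_
    rw [nsmul_eq_mul]
    exact mul_le_mul_of_nonneg_right (card_stripFiber_le β (by positivity) m) hC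
  have h1 := (tendsto_stripMean U β (add_pos hb hb') hc).add
    ((tendsto_avg_translate ha q.1).mono_left hU)
  rw [add_zero] at h1
  refine le_of_tendsto_of_tendsto' (tendsto_stripMean U β hb fun p => hc (p + q)) h1 fun k => ?_
  rw [stripAvg, stripAvg, sum_stripFinset, sum_stripFinset]
  simp only [a]
  rw [add_sub_cancel]
  refine mul_le_mul_of_nonneg_left (Finset.sum_le_sum fun m _ => ?_) (by positivity)
  refine (Finset.sum_map (stripFiber β b m) (addRightEmbedding q.2)
    fun n => c (m + q.1, n)).symm.trans_le ?_
  refine Finset.sum_le_sum_of_subset_of_nonneg ?_ fun n _ _ => h0 _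
  intro n hn
  rw [Finset.mem_map] at hn
  obtain ⟨n', hn', rfl⟩ := hn
  rw [mem_stripFiber] at hn' ⊢
  exact add_mem_strip hn' hq

/-- Average the pointwise bound `|c| ≤ δ⁻¹ c² + δ`, with `δ` chosen so that the constant term
contributes at most half of the mean of `|c|`. -/
theorem stripMean_sq_pos (hb : 0 < b) (hc : ∀ p, |c p| ≤ C)
    (h : 0 < stripMean U β b fun p => |c p|) : 0 < stripMean U β b fun p => c p ^ 2 := by
  set r := stripMean U β b fun p => |c p|
  have hsq : ∀ p, |c p ^ 2| ≤ C ^ 2 := fun p => by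
    rw [abs_pow]
    exact pow_le_pow_left₀ (abs_nonneg _) (hc p) 2
  set δ : ℝ := r / (2 * (b + 1)) with hδ
  have hδ0 : 0 < δ := by positivity
  have hδc : ∀ p : ℤ × ℤ, |(fun _ => δ) p| ≤ δ := fun _ => (abs_of_pos hδ0).le
  have hm := stripMean_mono (U := U) (β := β) (c := fun p => |c p|)
    (d := fun p => δ⁻¹ * c p ^ 2 + δ) (C := C) (D := δ⁻¹ * C ^ 2 + δ) hb
    (fun p => by rw [abs_abs]; exact hc p)
    (fun p => by
      rw [abs_of_nonneg (by positivity)]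
      have := hsq p
      rw [abs_of_nonneg (by positivity)] at this
      gcongr)
    (fun p => by
      rw [← sub_nonneg]
      have : δ⁻¹ * c p ^ 2 + δ - |c p| = δ⁻¹ * ((|c p| - δ / 2) ^ 2 + 3 / 4 * δ ^ 2) := by
        field_simp
        rw [← sq_abs (c p)]
        ring
      rw [this]
      positivity)
  rw [stripMean_add (C := δ⁻¹ * C ^ 2) (D := δ) hb (fun p => by
      rw [abs_mul, abs_of_pos (inv_pos.2 hδ0)]
      exact mul_le_mul_of_nonneg_left (hsq p) (by positivity)) hδc,
    stripMean_const_mul hb hsq] at hm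
  have h2 := (le_abs_self _).trans (abs_stripMean_le (U := U) (β := β) hb hδc)
  have h3 : δ * (b + 1) = r / 2 := by
    rw [hδ]
    field_simp
  have h4 : 0 < δ⁻¹ * stripMean U β b fun p => c p ^ 2 := by linarith
  exact (pos_iff_pos_of_mul_pos h4).1 (inv_pos.2 hδ0)

end DirWM
namespace DirWM

/-! ### Vectors with totally bounded orbit in a real Hilbert space. -/

section Hilbert

variable {H : Type*} [NormedAddCommGroup H] [InnerProductSpace ℝ H]

/-- A bounded set lying close to finite-dimensional subspaces is totally bounded. -/
theorem totallyBounded_of_finiteDimensional_approx {S : Set H} {R : ℝ} (hR : ∀ x ∈ S, ‖x‖ ≤ R)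
    (h : ∀ ε : ℝ, 0 < ε → ∃ K : Submodule ℝ H, FiniteDimensional ℝ K ∧
      ∀ x ∈ S, ∀ z ∈ Kᗮ, ‖z‖ = 1 → inner ℝ x z ≤ ε) : TotallyBounded S := by
  rw [Metric.totallyBounded_iff]
  intro ε hε
  obtain ⟨K, hK, hKS⟩ := h (ε / 2) (by positivity)
  have hball : TotallyBounded ((↑) '' (Metric.closedBall (0 : K) R) : Set H) :=
    ((isCompact_closedBall (0 : K) R).image continuous_subtype_val).totallyBounded
  obtain ⟨t, ht, hcov⟩ := Metric.totallyBounded_iff.1 hball (ε / 2) (by positivity)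
  refine ⟨t, ht, fun x hx => ?_⟩
  set y : K := K.orthogonalProjectionOnto x with hy
  have hyR : ‖y‖ ≤ R := (K.norm_orthogonalProjectionOnto_apply_le x).trans (hR x hx)
  have hmem := hcov ⟨y, by simpa using hyR, rfl⟩
  simp only [Set.mem_iUnion, exists_prop] at hmem ⊢
  obtain ⟨u, hu, hyu⟩ := hmem
  refine ⟨u, hu, ?_⟩
  have hdist : ‖x - y‖ ≤ ε / 2 := by
    by_cases h0 : x - (y : H) = 0
    · rw [h0, norm_zero]
      positivity
    have hv : x - (y : H) ∈ Kᗮ := K.sub_starProjection_mem_orthogonal x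
    have hpos : 0 < ‖x - (y : H)‖ := norm_pos_iff.2 h0
    -- Testing against the unit vector along `x - y` turns the hypothesis into a bound on the
    -- distance from `x` to `K`.
    have h1 := hKS x hx (‖x - (y : H)‖⁻¹ • (x - y)) (Kᗮ.smul_mem _ hv) (by
      rw [norm_smul, norm_inv, norm_norm, inv_mul_cancel₀ hpos.ne'])
    have h2 : inner ℝ x (x - (y : H)) = ‖x - (y : H)‖ ^ 2 := by
      have h3 : inner ℝ (y : H) (x - (y : H)) = 0 := hv y y.2
      rw [← real_inner_self_eq_norm_sq, inner_sub_left, h3, sub_zero]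
    rw [inner_smul_right, h2, pow_two, inv_mul_cancel_left₀ hpos.ne'] at h1
    exact h1
  rw [Metric.mem_ball, dist_eq_norm] at *
  calc ‖x - u‖ = ‖(x - y) + (y - u)‖ := by rw [sub_add_sub_cancel]
    _ ≤ ‖x - y‖ + ‖(y : H) - u‖ := norm_add_le _ _
    _ < ε := by linarith

/-- A nonnegative function whose sums over orthonormal families are bounded is small on the
unit vectors orthogonal to some finite-dimensional subspace. -/
theorem exists_finiteDimensional_forall_orthogonal_le {D : H → ℝ} {C : ℝ}
    (hD : ∀ (n : ℕ) (v : Fin n → H), Orthonormal ℝ v → ∑ i, D (v i) ≤ C) {δ : ℝ} (hδ : 0 < δ) :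
    ∃ K : Submodule ℝ H, FiniteDimensional ℝ K ∧ ∀ z ∈ Kᗮ, ‖z‖ = 1 → D z ≤ δ := by
  by_contra! hcon
  -- Otherwise arbitrarily long orthonormal families with `D > δ` can be built greedily, and their
  -- sums exceed `C`.
  have key : ∀ n : ℕ, ∃ v : Fin n → H, Orthonormal ℝ v ∧ ∀ i, δ < D (v i) := by
    intro n
    induction n with
    | zero => exact ⟨Fin.elim0, ⟨fun i => i.elim0, fun i => i.elim0⟩, fun i => i.elim0⟩
    | succ n ih =>
      obtain ⟨v, hv, hvD⟩ := ih
      obtain ⟨z, hz, hz1, hzD⟩ := hcon (Submodule.span ℝ (Set.range v))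
        (FiniteDimensional.span_of_finite ℝ (Set.finite_range v))
      refine ⟨Matrix.vecCons z v, orthonormal_vecCons_iff.2 ⟨hz1, fun i => ?_, hv⟩, fun i => ?_⟩
      · rw [real_inner_comm]
        exact hz (v i) (Submodule.subset_span ⟨i, rfl⟩)
      · refine Fin.cases ?_ (fun j => ?_) i
        · exact hzD
        · exact hvD j
  obtain ⟨n, hn⟩ := exists_nat_gt (C / δ)
  obtain ⟨v, hv, hvD⟩ := key n
  have h1 := hD n v hv
  have h2 : (n : ℝ) * δ ≤ ∑ i, D (v i) := by
    refine le_trans (by simp) (Finset.card_nsmul_le_sum Finset.univ (fun i => D (v i)) δ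
      fun i _ => (hvD i).le)
  rw [div_lt_iff₀ hδ] at hn
  linarith

/-- If the correlations of `g` and `h` along a strip do not vanish in mean square, then there is
a vector with totally bounded orbit along any given strip that correlates with `h` and is
orthogonal to everything that is orthogonal to the orbit of `g`. -/
theorem exists_totallyBounded_orbit [CompleteSpace H] (V : ℤ × ℤ → H →ₗᵢ[ℝ] H)
    (hV : ∀ p q x, V p (V q x) = V (p + q) x) (hV0 : ∀ x, V 0 x = x)
    {U : Ultrafilter ℕ} (hU : (U : Filter ℕ) ≤ atTop) {β b b' : ℝ} (hb : 0 < b) (hb' : 0 < b')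
    (g h : H) (hgh : 0 < stripMean U β b fun p => inner ℝ h (V p g) ^ 2) :
    ∃ w : H, TotallyBounded ((fun q => V q w) '' strip β b') ∧ 0 < inner ℝ w h ∧
      ∀ x, (∀ p, inner ℝ (V p g) x = 0) → inner ℝ w x = 0 := by
  have hbd : ∀ x p, |inner ℝ (V p g) x| ≤ ‖g‖ * ‖x‖ := fun x p =>
    (abs_real_inner_le_norm _ _).trans_eq (by rw [(V p).norm_map])
  have hbd' : ∀ p, |inner ℝ h (V p g)| ≤ ‖h‖ * ‖g‖ := fun p =>
    (abs_real_inner_le_norm _ _).trans_eq (by rw [(V p).norm_map])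
  have hbd2 : ∀ x p, |inner ℝ h (V p g) * inner ℝ (V p g) x| ≤ ‖h‖ * ‖g‖ * (‖g‖ * ‖x‖) :=
    fun x p => by
      rw [abs_mul]
      exact mul_le_mul (hbd' p) (hbd x p) (abs_nonneg _) (by positivity)
  -- By Riesz, `φ` is represented by `w`, the weak mean of `⟨h, V^p g⟩ V^p g`.
  let φ : StrongDual ℝ H := LinearMap.mkContinuous
    { toFun := fun x => stripMean U β b fun p => inner ℝ h (V p g) * inner ℝ (V p g) x
      map_add' := fun x y => by
        simp_rw [inner_add_right, mul_add]
        exact stripMean_add hb (hbd2 x) (hbd2 y)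
      map_smul' := fun r x => by
        simp_rw [inner_smul_right, mul_left_comm _ r]
        exact stripMean_const_mul hb (hbd2 x) r } (‖h‖ * ‖g‖ * ‖g‖ * (b + 1)) fun x => by
      refine (abs_stripMean_le hb (hbd2 x)).trans_eq ?_
      ring
  let w : H := (InnerProductSpace.toDual ℝ H).symm φ
  have hw : ∀ x, inner ℝ w x =
      stripMean U β b fun p => inner ℝ h (V p g) * inner ℝ (V p g) x := fun x =>
    InnerProductSpace.toDual_symm_apply
  -- The mean is over the wider strip, which absorbs translation by points of `strip β b'`. Bessel
  -- bounds the sums of `D` over orthonormal families.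
  let D : H → ℝ := fun z => stripMean U β (b + b') fun p => inner ℝ (V p g) z ^ 2
  have hsq : ∀ z p, |inner ℝ (V p g) z ^ 2| ≤ (‖g‖ * ‖z‖) ^ 2 := fun z p => by
    rw [abs_pow]
    exact pow_le_pow_left₀ (abs_nonneg _) (hbd z p) 2
  have hD : ∀ (n : ℕ) (v : Fin n → H), Orthonormal ℝ v →
      ∑ i, D (v i) ≤ ‖g‖ ^ 2 * (b + b' + 1) := by
    intro n v hv
    have hbessel : ∀ p, |∑ i, inner ℝ (V p g) (v i) ^ 2| ≤ ‖g‖ ^ 2 := fun p => by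
      rw [abs_of_nonneg (Finset.sum_nonneg fun i _ => sq_nonneg _), ← (V p).norm_map g]
      refine le_trans (le_of_eq ?_) (hv.sum_inner_products_le (V p g) (s := Finset.univ))
      refine Finset.sum_congr rfl fun i _ => ?_
      rw [Real.norm_eq_abs, sq_abs, real_inner_comm]
    rw [← stripMean_sum (C := ‖g‖ ^ 2) Finset.univ (add_pos hb hb') fun i p => by
      simpa [hv.1 i] using hsq (v i) p]
    exact (le_abs_self _).trans (abs_stripMean_le (add_pos hb hb') hbessel)
  set A : ℝ := ‖h‖ * ‖g‖ with hA
  have hA0 : 0 ≤ A := by positivity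
  -- Moving `V q` onto `z` replaces `⟨V p g, z⟩` by `⟨V (p + q) g, z⟩`. Splitting the product as
  -- `A|s| ≤ τ A² + τ⁻¹ s²` and removing the translation by `q` gives a bound independent of `q`.
  have hkey : ∀ q ∈ strip β b', ∀ z, ∀ τ : ℝ, 0 < τ →
      inner ℝ (V q w) z ≤ τ * A ^ 2 * (b + 1) + τ⁻¹ * D z := by
    intro q hq z τ hτ
    have hadj : ∀ x, inner ℝ (V q x) z = inner ℝ x (V (-q) z) := fun x => by
      rw [← (V q).inner_map_map x, hV, add_neg_cancel, hV0]
    have hadj2 : ∀ p, inner ℝ (V p g) (V (-q) z) = inner ℝ (V (p + q) g) z := fun p => by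
      rw [← hadj, hV, add_comm]
    rw [hadj, hw]
    have hc1 : ∀ p : ℤ × ℤ, |(fun _ => τ * A ^ 2) p| ≤ τ * A ^ 2 := fun p =>
      (abs_of_nonneg (by positivity)).le
    have hsq' : ∀ p, |inner ℝ (V (p + q) g) z ^ 2| ≤ (‖g‖ * ‖z‖) ^ 2 := fun p => hsq z (p + q)
    have hc2 : ∀ p, |τ⁻¹ * inner ℝ (V (p + q) g) z ^ 2| ≤ τ⁻¹ * (‖g‖ * ‖z‖) ^ 2 := fun p => by
      rw [abs_mul, abs_of_pos (inv_pos.2 hτ)]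
      exact mul_le_mul_of_nonneg_left (hsq' p) (by positivity)
    refine (stripMean_mono (D := τ * A ^ 2 + τ⁻¹ * (‖g‖ * ‖z‖) ^ 2)
      (d := fun p => τ * A ^ 2 + τ⁻¹ * inner ℝ (V (p + q) g) z ^ 2)
      hb (hbd2 _) (fun p => (abs_add_le _ _).trans (add_le_add (hc1 p) (hc2 p)))
      fun p => ?_).trans ?_
    · rw [hadj2]
      set s := inner ℝ (V (p + q) g) z
      have h1 : inner ℝ h (V p g) * s ≤ A * |s| := by
        refine (le_abs_self _).trans ?_
        rw [abs_mul]
        exact mul_le_mul_of_nonneg_right (hbd' p) (abs_nonneg _)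
      have h2 : τ * A ^ 2 + τ⁻¹ * s ^ 2 - A * |s| =
          τ⁻¹ * ((|s| - τ * A / 2) ^ 2 + 3 / 4 * (τ * A) ^ 2) := by
        field_simp
        rw [← sq_abs s]
        ring
      have h3 : 0 ≤ τ⁻¹ * ((|s| - τ * A / 2) ^ 2 + 3 / 4 * (τ * A) ^ 2) := by positivity
      linarith
    · rw [stripMean_add hb hc1 hc2, stripMean_const_mul hb hsq']
      refine add_le_add ((le_abs_self _).trans (abs_stripMean_le hb hc1)) ?_
      exact mul_le_mul_of_nonneg_left
        (stripMean_translate_le hU hb hb' (hsq z) (fun p => sq_nonneg _) hq) (by positivity)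
  refine ⟨w, totallyBounded_of_finiteDimensional_approx (R := ‖w‖) ?_ fun ε hε => ?_, ?_, ?_⟩
  · rintro _ ⟨q, -, rfl⟩
    exact ((V q).norm_map w).le
  -- `τ` makes the first term of `hkey` at most `ε / 2`; `K` is then chosen so that `τ⁻¹ D z ≤ ε /
  -- 2` on its orthogonal unit vectors.
  · set τ : ℝ := ε / (2 * (A ^ 2 * (b + 1) + 1)) with hτ
    have hτ0 : 0 < τ := by positivity
    obtain ⟨K, hK, hKD⟩ := exists_finiteDimensional_forall_orthogonal_le hD
      (show 0 < τ * (ε / 2) by positivity)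
    refine ⟨K, hK, ?_⟩
    rintro _ ⟨q, hq, rfl⟩ z hz hz1
    refine (hkey q hq z τ hτ0).trans ?_
    have h1 : τ⁻¹ * D z ≤ ε / 2 := by
      rw [inv_mul_le_iff₀ hτ0]
      exact hKD z hz hz1
    have h2 : τ * (A ^ 2 * (b + 1) + 1) = ε / 2 := by
      rw [hτ]
      field_simp
    linarith
  · rw [hw]
    convert hgh using 3 with p
    rw [real_inner_comm h, ← pow_two]
  · intro x hx
    rw [hw]
    simp_rw [hx, mul_zero]
    have := abs_stripMean_le (U := U) (β := β) hb (c := fun _ => 0) (C := 0) (by simp)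
    simpa using this

end Hilbert

end DirWM
namespace DirWM

/-! ### Centered indicators in real `L²`. -/

section Measure

variable {X : Type*} [MeasurableSpace X]

theorem Lp_compMeasurePreserving_congr (μ : Measure X) {E : Type*} [NormedAddCommGroup E] {f f' : X → X}
    (h : f = f') (hf : MeasurePreserving f μ μ) (hf' : MeasurePreserving f' μ μ) (x : Lp E 2 μ) :
    Lp.compMeasurePreserving f hf x = Lp.compMeasurePreserving f' hf' x := by
  subst h
  rfl

theorem correlationAverage_nonneg [AddAction (ℤ × ℤ) X] (μ : Measure X) (β b : ℝ) (B C : Set X) (k : ℕ) :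
    0 ≤ correlationAverage μ β b B C k :=
  mul_nonneg (by positivity) (Finset.sum_nonneg fun _ _ => abs_nonneg _)

/-- A nonzero function of mean zero takes positive values with positive probability. -/
theorem measure_setOf_pos_ne_zero {μ : Measure X} {w : X → ℝ} (hw : Integrable w μ) (h0 : ¬ w =ᵐ[μ] 0)
    (hint : ∫ x, w x ∂μ = 0) : μ {x | 0 < w x} ≠ 0 := by
  intro h
  have h1 : 0 ≤ᵐ[μ] fun x => -w x := by
    have : ∀ᵐ x ∂μ, ¬ 0 < w x := by rw [ae_iff]; simpa using h
    filter_upwards [this] with x hx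
    simpa using hx
  have h2 := (integral_eq_zero_iff_of_nonneg_ae h1 hw.fun_neg).1 (by rw [integral_neg, hint, neg_zero])
  refine h0 ?_
  filter_upwards [h2] with x hx
  simpa using hx

variable {μ : Measure X} [IsProbabilityMeasure μ]

/-- The measurable set `B` as a vector of real `L²`, with its mean subtracted. -/
noncomputable def centeredIndicator (μ : Measure X) [IsProbabilityMeasure μ] {B : Set X}
    (hB : MeasurableSet B) : Lp ℝ 2 μ :=
  indicatorConstLp 2 hB (measure_ne_top μ B) 1 -
    μ.real B • indicatorConstLp 2 MeasurableSet.univ (measure_ne_top μ Set.univ) 1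

theorem inner_centeredIndicator_univ {B : Set X} (hB : MeasurableSet B) :
    inner ℝ (centeredIndicator μ hB)
      (indicatorConstLp 2 MeasurableSet.univ (measure_ne_top μ Set.univ) 1) = 0 := by
  rw [centeredIndicator, inner_sub_left, real_inner_smul_left,
    L2.real_inner_indicatorConstLp_one_indicatorConstLp_one,
    L2.real_inner_indicatorConstLp_one_indicatorConstLp_one]
  simp

/-- Centering turns the correlation differences into inner products, to which the Hilbert space
argument applies. -/
theorem inner_centeredIndicator {B C : Set X} (hB : MeasurableSet B) (hC : MeasurableSet C) :
    inner ℝ (centeredIndicator μ hC) (centeredIndicator μ hB) =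
      μ.real (B ∩ C) - μ.real B * μ.real C := by
  have h : centeredIndicator μ hB = indicatorConstLp 2 hB (measure_ne_top μ B) 1 -
      μ.real B • indicatorConstLp 2 MeasurableSet.univ (measure_ne_top μ Set.univ) 1 := rfl
  rw [h, inner_sub_right, real_inner_smul_right, inner_centeredIndicator_univ, centeredIndicator,
    inner_sub_left, real_inner_smul_left, L2.real_inner_indicatorConstLp_one_indicatorConstLp_one,
    L2.real_inner_indicatorConstLp_one_indicatorConstLp_one, Set.univ_inter, Set.inter_comm]
  ring

end Measure

/-! ### Koopman operators, the Kronecker algebra and the two implications. -/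

section Koopman

variable {X : Type*} [MeasurableSpace X] [AddAction (ℤ × ℤ) X] [MeasurableConstVAdd (ℤ × ℤ) X]
  (μ : Measure X) [VAddInvariantMeasure (ℤ × ℤ) X μ]

/-- Composition operators multiply in reverse order; commutativity of `ℤ²` makes this harmless. -/
theorem Lp_compMeasurePreserving_vadd {E : Type*} [NormedAddCommGroup E] (p q : ℤ × ℤ)
    (x : Lp E 2 μ) :
    Lp.compMeasurePreserving (fun y : X => p +ᵥ y) (measurePreserving_vadd p μ)
      (Lp.compMeasurePreserving (fun y : X => q +ᵥ y) (measurePreserving_vadd q μ) x) =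
    Lp.compMeasurePreserving (fun y : X => (p + q) +ᵥ y) (measurePreserving_vadd (p + q) μ) x := by
  rw [← Lp.compMeasurePreserving_comp_apply]
  refine Lp_compMeasurePreserving_congr μ ?_ _ _ x
  funext y
  rw [Function.comp_apply, vadd_vadd, add_comm]

theorem koopman_koopman (p q : ℤ × ℤ) (x : Lp ℂ 2 μ) :
    koopman μ p (koopman μ q x) = koopman μ (p + q) x :=
  Lp_compMeasurePreserving_vadd μ p q x

/-- The Koopman operator on the real Hilbert space `L²(X, μ)`. -/
noncomputable def realKoopman (p : ℤ × ℤ) : Lp ℝ 2 μ →ₗᵢ[ℝ] Lp ℝ 2 μ :=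
  Lp.compMeasurePreservingₗᵢ ℝ (fun x : X => p +ᵥ x) (measurePreserving_vadd p μ)

theorem realKoopman_realKoopman (p q : ℤ × ℤ) (x : Lp ℝ 2 μ) :
    realKoopman μ p (realKoopman μ q x) = realKoopman μ (p + q) x :=
  Lp_compMeasurePreserving_vadd μ p q x

theorem realKoopman_zero (x : Lp ℝ 2 μ) : realKoopman μ 0 x = x :=
  (Lp_compMeasurePreserving_congr μ (funext fun y => zero_vadd _ y) _ (.id μ) x).trans
    (Lp.compMeasurePreserving_id_apply x)

theorem coeFn_realKoopman (p : ℤ × ℤ) (x : Lp ℝ 2 μ) :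
    realKoopman μ p x =ᵐ[μ] fun y => x (p +ᵥ y) :=
  Lp.coeFn_compMeasurePreserving x (measurePreserving_vadd p μ)

theorem measurableSet_preimage_vadd {B : Set X} (hB : MeasurableSet B) (p : ℤ × ℤ) :
    MeasurableSet ((fun x : X => p +ᵥ x) ⁻¹' B) :=
  hB.preimage (measurable_const_vadd p)

theorem measureReal_preimage_vadd' {B : Set X} (hB : MeasurableSet B) (p : ℤ × ℤ) :
    μ.real ((fun x : X => p +ᵥ x) ⁻¹' B) = μ.real B :=
  (measurePreserving_vadd p μ).measureReal_preimage hB.nullMeasurableSet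

variable [IsProbabilityMeasure μ]

theorem realKoopman_indicatorConstLp {B : Set X} (hB : MeasurableSet B) (p : ℤ × ℤ) :
    realKoopman μ p (indicatorConstLp 2 hB (measure_ne_top μ B) 1) =
      indicatorConstLp 2 (measurableSet_preimage_vadd hB p) (measure_ne_top μ _) 1 :=
  rfl

/-- Both vectors have squared norm `μ(B)`, so closeness in `L²` amounts to a large overlap of the
translated sets. -/
theorem norm_koopman_indicator_sub_sq {B : Set X} (hB : MeasurableSet B) (p q : ℤ × ℤ) :
    ‖koopman μ p (indicatorConstLp 2 hB (measure_ne_top μ B) (1 : ℂ)) -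
      koopman μ q (indicatorConstLp 2 hB (measure_ne_top μ B) (1 : ℂ))‖ ^ 2 =
    2 * (μ.real B - μ.real ((fun x : X => p +ᵥ x) ⁻¹' B ∩ (fun x : X => q +ᵥ x) ⁻¹' B)) := by
  have h : ∀ r : ℤ × ℤ, koopman μ r (indicatorConstLp 2 hB (measure_ne_top μ B) (1 : ℂ)) =
      indicatorConstLp 2 (measurableSet_preimage_vadd hB r) (measure_ne_top μ _) (1 : ℂ) :=
    fun r => rfl
  have hn : ∀ r : ℤ × ℤ,
      ‖koopman μ r (indicatorConstLp 2 hB (measure_ne_top μ B) (1 : ℂ))‖ ^ 2 = μ.real B := by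
    intro r
    rw [LinearIsometry.norm_map, @norm_sq_eq_re_inner ℂ,
      L2.inner_indicatorConstLp_one_indicatorConstLp_one, Set.inter_self]
    simp
  rw [@norm_sub_sq ℂ, hn, hn, h, h, L2.inner_indicatorConstLp_one_indicatorConstLp_one]
  simp only [Complex.coe_algebraMap, RCLike.re_to_complex, Complex.ofReal_re]
  ring

variable {μ}

/-- The orbit along any strip lies in finitely many isometric images of the orbit along `strip β
b₀`; hence the choice of `b₀` is immaterial. -/
theorem totallyBounded_orbit_of_mem_kroneckerAlgebra {β b₀ : ℝ} (hb₀ : 0 < b₀) {B : Set X}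
    (hB : MeasurableSet B) (h : B ∈ kroneckerAlgebra μ β b₀) (b : ℝ) :
    TotallyBounded ((fun p : ℤ × ℤ => koopman μ p
      (indicatorConstLp 2 hB (measure_ne_top μ B) (1 : ℂ))) '' strip β b) := by
  obtain ⟨_, hc⟩ := h
  obtain ⟨F, hF⟩ := exists_finset_cover_strip β hb₀ b
  have h0 := totallyBounded_closure.1 hc.totallyBounded
  refine TotallyBounded.subset ?_ ((totallyBounded_biUnion F.finite_toSet).2 fun f _ =>
    h0.image (koopman μ f).isometry.uniformContinuous)
  rintro _ ⟨p, hp, rfl⟩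
  obtain ⟨f, hf, hfp⟩ := hF p hp
  refine Set.mem_biUnion (Finset.mem_coe.2 hf) ⟨_, ⟨p - f, hfp, rfl⟩, ?_⟩
  dsimp only
  rw [koopman_koopman, add_sub_cancel]

/-- If the averages over some strip vanish, then the Kronecker algebra is trivial. -/
theorem AveragesVanish.isWeakMixing {β b b₀ : ℝ} (hb : 0 < b) (hb₀ : 0 < b₀)
    (h : AveragesVanish μ β b) : IsWeakMixing μ β b₀ := by
  intro B hBK
  obtain ⟨hB, -⟩ := id hBK
  set m := μ.real B with hm
  have hm1 : m ≤ 1 := measureReal_le_one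
  have hm0 : 0 ≤ m := measureReal_nonneg
  suffices hmm : m - m * m ≤ 0 by
    have : m = 0 ∨ m = 1 := by
      have : m * (1 - m) = 0 := le_antisymm (by linarith) (mul_nonneg hm0 (by linarith))
      rcases mul_eq_zero.1 this with h | h
      · exact Or.inl h
      · exact Or.inr (by linarith)
    refine this.imp (fun h0 => ?_) fun h1 => ?_
    · exact (measureReal_eq_zero_iff (measure_ne_top μ B)).1 h0
    · rw [← ENNReal.ofReal_toReal (measure_ne_top μ B)]
      rw [show (μ B).toReal = 1 from h1, ENNReal.ofReal_one]
  by_contra! hpos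
  set η := m - m * m with hη
  -- At distance below `√η` the overlap exceeds `m - η / 2`, so the correlation exceeds `m * m` by
  -- more than `η / 2`.
  obtain ⟨P, -, hP⟩ := exists_finset_net
    (totallyBounded_orbit_of_mem_kroneckerAlgebra hb₀ hB hBK b) (Real.sqrt_pos.2 hpos)
  have hlim : Tendsto (fun k => ∑ q ∈ P,
      correlationAverage μ β b B ((fun x : X => q +ᵥ x) ⁻¹' B) k) atTop (𝓝 0) := by
    simpa using tendsto_finsetSum P fun q _ => h B _ hB (measurableSet_preimage_vadd hB q)
  have hge : ∀ᶠ k : ℕ in atTop, η / 2 ≤ ∑ q ∈ P,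
      correlationAverage μ β b B ((fun x : X => q +ᵥ x) ⁻¹' B) k := by
    filter_upwards [eventually_gt_atTop 0] with k hk
    have hcard : 0 < (stripFinset β b k).card := Finset.card_pos.2
      ⟨0, mem_stripFinset.2 ⟨zero_mem_strip β hb, le_rfl, by simpa using hk⟩⟩
    have hcard' : (0 : ℝ) < (stripFinset β b k).card := by exact_mod_cast hcard
    simp_rw [correlationAverage]
    rw [← Finset.mul_sum, Finset.sum_comm, one_div, le_inv_mul_iff₀ hcard', ← nsmul_eq_mul]
    refine Finset.card_nsmul_le_sum _ _ _ fun p hp => ?_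
    obtain ⟨q, hq, hd⟩ := hP p (mem_stripFinset.1 hp).1
    refine le_trans ?_ (Finset.single_le_sum (f := fun q : ℤ × ℤ =>
      |μ.real ((fun x : X => p +ᵥ x) ⁻¹' B ∩ (fun x : X => q +ᵥ x) ⁻¹' B) -
        μ.real B * μ.real ((fun x : X => q +ᵥ x) ⁻¹' B)|) (fun _ _ => abs_nonneg _) hq)
    rw [measureReal_preimage_vadd' μ hB, ← hm]
    rw [dist_eq_norm, Real.lt_sqrt (norm_nonneg _), norm_koopman_indicator_sub_sq, ← hm] at hd
    refine le_trans ?_ (le_abs_self _)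
    linarith
  have := ge_of_tendsto hlim hge
  linarith

/-- The positivity set of a function with totally bounded orbit along a strip belongs to the
Kronecker algebra. -/
theorem setOf_pos_mem_kroneckerAlgebra {β b : ℝ} {w : Lp ℝ 2 μ}
    (hw : TotallyBounded ((fun p => realKoopman μ p w) '' strip β b)) :
    {x | 0 < w x} ∈ kroneckerAlgebra μ β b := by
  have hmeas : Measurable w := (Lp.stronglyMeasurable w).measurable
  have hB : MeasurableSet {x | 0 < w x} := measurableSet_lt measurable_const hmeas
  refine ⟨hB, TotallyBounded.isCompact_of_isClosed (totallyBounded_closure.2 ?_) isClosed_closure⟩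
  rw [Metric.totallyBounded_iff]
  intro ε hε
  -- The layers exclude the level `0` itself and decrease to `∅`, so the threshold `0` works even if
  -- `{w = 0}` has positive measure.
  have hlim : Tendsto (fun n : ℕ => μ {x | 0 < w x ∧ w x ≤ 1 / ((n : ℝ) + 1)}) atTop (𝓝 0) := by
    have := tendsto_measure_iInter_atTop (μ := μ)
      (s := fun n : ℕ => {x | 0 < w x ∧ w x ≤ 1 / ((n : ℝ) + 1)})
      (fun n => (hB.inter (measurableSet_le hmeas measurable_const)).nullMeasurableSet)
      (fun i j hij x hx => ⟨hx.1, hx.2.trans (by gcongr)⟩) ⟨0, measure_ne_top μ _⟩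
    rwa [show (⋂ n : ℕ, {x | 0 < w x ∧ w x ≤ 1 / ((n : ℝ) + 1)}) = ∅ from ?_,
      measure_empty] at this
    refine Set.eq_empty_of_forall_notMem fun x hx => ?_
    rw [Set.mem_iInter] at hx
    obtain ⟨n, hn⟩ := exists_nat_one_div_lt (hx 0).1
    exact absurd (hx n).2 (not_le.2 hn)
  have hε2 : (0 : ENNReal) < ENNReal.ofReal (ε ^ 2 / 8) := ENNReal.ofReal_pos.2 (by positivity)
  obtain ⟨n, hn⟩ := (hlim.eventually_lt_const hε2).exists
  set δ : ℝ := 1 / ((n : ℝ) + 1) with hδ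
  have hδ0 : 0 < δ := by positivity
  -- Chebyshev at height `δ` then costs `(ε / 4)² = ε² / 16`; with `ε² / 8` for the layer, the
  -- squared distance is at most `3ε² / 8`.
  obtain ⟨P, -, hP⟩ := exists_finset_net hw (show 0 < δ * (ε / 4) by positivity)
  refine ⟨(fun p : ℤ × ℤ => koopman μ p
    (indicatorConstLp 2 hB (measure_ne_top μ _) (1 : ℂ))) '' P, P.finite_toSet.image _, ?_⟩
  rintro _ ⟨p, hp, rfl⟩
  obtain ⟨q, hq, hd⟩ := hP p hp
  simp only [Set.mem_iUnion, exists_prop]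
  refine ⟨_, ⟨q, Finset.mem_coe.2 hq, rfl⟩, ?_⟩
  rw [Metric.mem_ball, dist_eq_norm]
  refine lt_of_pow_lt_pow_left₀ 2 hε.le ?_
  rw [norm_koopman_indicator_sub_sq]
  set Bp : Set X := (fun x : X => p +ᵥ x) ⁻¹' {x | 0 < w x}
  set Bq : Set X := (fun x : X => q +ᵥ x) ⁻¹' {x | 0 < w x}
  have hdiff : μ.real {x | 0 < w x} - μ.real (Bp ∩ Bq) = μ.real (Bp \ Bq) := by
    rw [← measureReal_preimage_vadd' μ hB p,
      ← measureReal_inter_add_sdiff (s := Bp) (measurableSet_preimage_vadd hB q)]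
    ring
  have hcheb : μ {x | δ ≤ |w (p +ᵥ x) - w (q +ᵥ x)|} ≤ ENNReal.ofReal (ε ^ 2 / 16) := by
    have h1 := Lp.meas_ge_le_mul_pow_enorm (realKoopman μ p w - realKoopman μ q w)
      two_ne_zero ENNReal.ofNat_ne_top (ε := ENNReal.ofReal δ) (ENNReal.ofReal_pos.2 hδ0).ne'
    have h2 : (μ {x | δ ≤ |w (p +ᵥ x) - w (q +ᵥ x)|}) = μ {x | ENNReal.ofReal δ ≤
        ‖(realKoopman μ p w - realKoopman μ q w : Lp ℝ 2 μ) x‖₊} := by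
      refine measure_congr ?_
      filter_upwards [Lp.coeFn_sub (realKoopman μ p w) (realKoopman μ q w),
        coeFn_realKoopman μ p w, coeFn_realKoopman μ q w] with x h3 h4 h5
      refine propext ?_
      change δ ≤ _ ↔ ENNReal.ofReal δ ≤
        ‖(realKoopman μ p w - realKoopman μ q w : Lp ℝ 2 μ) x‖ₑ
      rw [h3, Pi.sub_apply, h4, h5, ← ofReal_norm, ENNReal.ofReal_le_ofReal_iff (norm_nonneg _),
        Real.norm_eq_abs]
    rw [h2]
    refine h1.trans ?_
    rw [← ENNReal.mul_rpow_of_nonneg _ _ (by simp), ← ENNReal.ofReal_inv_of_pos hδ0,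
      ← ENNReal.ofReal_mul (by positivity), ENNReal.toReal_ofNat, ENNReal.rpow_ofNat,
      ← ENNReal.ofReal_pow (by positivity)]
    refine ENNReal.ofReal_le_ofReal ?_
    rw [dist_eq_norm] at hd
    calc (δ⁻¹ * ‖realKoopman μ p w - realKoopman μ q w‖) ^ 2 ≤ (δ⁻¹ * (δ * (ε / 4))) ^ 2 := by
          gcongr
      _ = ε ^ 2 / 16 := by
          field_simp
          norm_num
  have hsmall : μ ((fun x : X => p +ᵥ x) ⁻¹' {x | 0 < w x ∧ w x ≤ δ}) ≤
      ENNReal.ofReal (ε ^ 2 / 8) := by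
    have hm : MeasurableSet {x | 0 < w x ∧ w x ≤ δ} :=
      hB.inter (measurableSet_le hmeas measurable_const)
    exact ((measurePreserving_vadd p μ).measure_preimage hm.nullMeasurableSet).trans_le hn.le
  -- Where `w` is positive at `p +ᵥ x` but not at `q +ᵥ x`, either the first value lies in the thin
  -- layer or the two differ by at least `δ`.
  have hsub : Bp \ Bq ⊆ (fun x : X => p +ᵥ x) ⁻¹' {x | 0 < w x ∧ w x ≤ δ} ∪
      {x | δ ≤ |w (p +ᵥ x) - w (q +ᵥ x)|} := by
    rintro x ⟨hx1, hx2⟩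
    have hx1' : 0 < w (p +ᵥ x) := hx1
    have hx2' : w (q +ᵥ x) ≤ 0 := not_lt.1 hx2
    by_cases hx : w (p +ᵥ x) ≤ δ
    · exact Or.inl ⟨hx1', hx⟩
    · refine Or.inr (show δ ≤ |_| from le_trans ?_ (le_abs_self _))
      linarith
  have hfin : μ (Bp \ Bq) ≤ ENNReal.ofReal (ε ^ 2 / 8 + ε ^ 2 / 16) := by
    rw [ENNReal.ofReal_add (by positivity) (by positivity)]
    exact (measure_mono hsub).trans ((measure_union_le _ _).trans (add_le_add hsmall hcheb))
  have hfin' : μ.real (Bp \ Bq) ≤ ε ^ 2 / 8 + ε ^ 2 / 16 :=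
    ENNReal.toReal_le_of_le_ofReal (by positivity) hfin
  rw [hdiff]
  nlinarith [sq_pos_of_pos hε]

theorem realKoopman_centeredIndicator {B : Set X} (hB : MeasurableSet B) (p : ℤ × ℤ) :
    realKoopman μ p (centeredIndicator μ hB) =
      centeredIndicator μ (measurableSet_preimage_vadd hB p) := by
  rw [centeredIndicator, centeredIndicator, map_sub, map_smul, realKoopman_indicatorConstLp,
    realKoopman_indicatorConstLp, measureReal_preimage_vadd' μ hB]
  rfl

/-- If the Kronecker algebra is trivial, then the averages over every strip vanish. -/
theorem IsWeakMixing.averagesVanish {β b₀ : ℝ} (hb₀ : 0 < b₀) (h : IsWeakMixing μ β b₀) {b : ℝ}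
    (hb : 0 < b) : AveragesVanish μ β b := by
  intro B C hB hC
  by_contra hcon
  obtain ⟨ε, hε, hfreq⟩ : ∃ ε > 0, ∃ᶠ k in atTop, ε ≤ correlationAverage μ β b B C k := by
    by_contra! hall
    refine hcon (tendsto_order.2 ⟨fun a ha => Eventually.of_forall fun k =>
      ha.trans_le (correlationAverage_nonneg μ β b B C k), fun a ha => ?_⟩)
    simpa using hall a ha
  obtain ⟨L, hL, hLk⟩ := exists_le_mul_card_stripFinset β hb
  have hne := frequently_iff_neBot.1 (hfreq.and_eventually hLk)
  -- The ultrafilter lives on the times `k` at which the average stays above `ε`.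
  obtain ⟨U, hU⟩ := Filter.exists_ultrafilter_le
    (atTop ⊓ 𝓟 {k : ℕ | ε ≤ correlationAverage μ β b B C k ∧
      (k : ℝ) ≤ L * (stripFinset β b k).card})
  have hUtop : (U : Filter ℕ) ≤ atTop := hU.trans inf_le_left
  have hUev : ∀ᶠ k in (U : Filter ℕ), ε ≤ correlationAverage μ β b B C k ∧
      (k : ℝ) ≤ L * (stripFinset β b k).card := (le_principal_iff.1 (hU.trans inf_le_right))
  set g := centeredIndicator μ hB
  set f := centeredIndicator μ hC
  let c : ℤ × ℤ → ℝ := fun p => inner ℝ f (realKoopman μ p g)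
  have hcdef : ∀ p, c p =
      μ.real ((fun x : X => p +ᵥ x) ⁻¹' B ∩ C) - μ.real B * μ.real C := fun p => by
    simp only [c, f, g]
    rw [realKoopman_centeredIndicator, inner_centeredIndicator, measureReal_preimage_vadd' μ hB]
  have hcbd : ∀ p, |c p| ≤ ‖f‖ * ‖g‖ := fun p =>
    (abs_real_inner_le_norm _ _).trans_eq (by rw [LinearIsometry.norm_map])
  have hpos : 0 < stripMean U β b fun p => |c p| := by
    -- At these times the sum is at least `ε · #Λ_k ≥ ε k / L`, and `stripAvg` divides by `k`.
    refine lt_of_lt_of_le (show 0 < ε / L by positivity)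
      (ge_of_tendsto (tendsto_stripMean U β hb (C := ‖f‖ * ‖g‖) fun p => by
        rw [abs_abs]; exact hcbd p) ?_)
    filter_upwards [hUev, hUtop (eventually_gt_atTop 0)] with k ⟨hk1, hk2⟩ hk0
    have hk0' : (0 : ℝ) < k := by exact_mod_cast hk0
    have hcard : (0 : ℝ) < (stripFinset β b k).card := by
      by_contra! hneg
      nlinarith
    rw [correlationAverage, one_div, le_inv_mul_iff₀ hcard] at hk1
    simp_rw [stripAvg, hcdef]
    rw [one_div, le_inv_mul_iff₀ hk0', mul_div_assoc', div_le_iff₀ hL]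
    nlinarith
  obtain ⟨w, hwtb, hwf, hworth⟩ := exists_totallyBounded_orbit (realKoopman μ)
    (realKoopman_realKoopman μ) (realKoopman_zero μ) hUtop hb hb₀ g f
    (stripMean_sq_pos hb hcbd hpos)
  have hw0 : w ≠ 0 := by
    rintro rfl
    simp at hwf
  have hwint : Integrable w μ := (Lp.memLp w).integrable one_le_two
  -- The whole orbit of `g` is orthogonal to the constants, hence so is `w`.
  have hwmean : ∫ x, w x ∂μ = 0 := by
    have h1 := hworth (indicatorConstLp 2 MeasurableSet.univ (measure_ne_top μ Set.univ) 1)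
      fun p => by
        simp only [g]
        rw [realKoopman_centeredIndicator, inner_centeredIndicator_univ]
    rwa [real_inner_comm, L2.inner_indicatorConstLp_one, setIntegral_univ] at h1
  have hwae : ¬ w =ᵐ[μ] 0 := fun hae => hw0 (Lp.eq_zero_iff_ae_eq_zero.2 hae)
  rcases h _ (setOf_pos_mem_kroneckerAlgebra hwtb) with h0 | h1
  · exact measure_setOf_pos_ne_zero hwint hwae hwmean h0
  · have hmeas : MeasurableSet {x | 0 < w x} :=
      measurableSet_lt measurable_const (Lp.stronglyMeasurable w).measurable
    -- Full measure of `{w > 0}` would make `{-w > 0}` null, which is excluded in the same way.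
    refine measure_setOf_pos_ne_zero (w := fun x => -w x) hwint.fun_neg (fun hae => hwae ?_)
      (by rw [integral_neg, hwmean, neg_zero]) ?_
    · filter_upwards [hae] with x hx
      simpa using hx
    · refine measure_mono_null (fun x hx => ?_) ((prob_compl_eq_zero_iff hmeas).2 h1)
      simp only [Set.mem_ofPred_eq, Set.mem_compl_iff] at hx ⊢
      linarith

end Koopman

end DirWM

theorem mainTheorem1 {X : Type*} [MeasurableSpace X] [AddAction (ℤ × ℤ) X]
    [MeasurableConstVAdd (ℤ × ℤ) X] (μ : Measure X) [IsProbabilityMeasure μ]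
    [VAddInvariantMeasure (ℤ × ℤ) X μ] (β : ℝ) (b₀ : ℝ) (hb₀ : 0 < b₀) :
    [DirWM.IsWeakMixing μ β b₀,
      ∃ b : ℝ, 0 < b ∧ DirWM.AveragesVanish μ β b,
      ∀ b : ℝ, 0 < b → DirWM.AveragesVanish μ β b].TFAE := by
  tfae_have 1 → 3 := fun h b hb => h.averagesVanish hb₀ hb
  tfae_have 3 → 2 := fun h => ⟨1, one_pos, h 1 one_pos⟩
  tfae_have 2 → 1 := fun ⟨b, hb, h⟩ => h.isWeakMixing hb hb₀
  tfae_finish
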